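/- Let $(\Omega,\mu)$ be a $\sigma$-compact topological space with a positive regular Borel measure, $K:\Omega\to\mathbb{C}$ locally integrable, $n\ge 1$, and let $(A(u))_{u\in\Omega}$ be a $\mu$-measurable, pairwise commuting family of real symmetric negative definite $n\times n$ matrices such that $|\det A(u)|^{-1/2}K(u)\in L^1(\Omega,\mu)$. Then there are an orthogonal matrix $C$ and vectors $a(u)=(a_1(u),\dots,a_n(u))$ with $\mathrm{diag}(a_1(u),\dots,a_n(u))=C^{-1}A(u)C$ for all $u\in\Omega$, and $$(\mathcal{H}f)(x)=\int_\Omega K(u)f(A(u)x)\,d\mu(u)$$ defines a bounded operator $\mathcal{H}$ on $L^2(\mathbb{R}^n)$ (for every $f$ the integral converges absolutely for almost every $x$). Moreover there is an enumeration $U_1,\dots,U_{2^n}$ of the open hyperoctants of $\mathbb{R}^n$ such that for all $C$ and $a$ as above the following holds. For $s\in\mathbb{R}^n$ put $|a(u)|^{-1/2-\imath s}:=\prod_{k=1}^n\exp\bigl((-\tfrac12-\imath s_k)\log|a_k(u)|\bigr)$ and $$\varphi(s)=\int_\Omega K(u)|a(u)|^{-1/2-\imath s}\,d\mu(u).$$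 Let $\varepsilon(i;j)\in\{-1,1\}^n$ be the unique sign vector that maps $U_i$ onto $U_j$ by coordinate-wise multiplication, let $\Omega_{ij}=\{u\in\Omega:(\mathrm{sgn}\,a_1(u),\dots,\mathrm{sgn}\,a_n(u))=\varepsilon(i;j)\}$, and let $\Phi(s)=(\varphi_{ij}(s))_{i,j=1}^{2^n}$ with $\varphi_{ij}(s)=\int_{\Omega_{ij}}K(u)|a(u)|^{-1/2-\imath s}\,d\mu(u)$ be the matrix symbol of $\mathcal{H}$. Then for all $s\in\mathbb{R}^n$ $$\Phi(s)=\begin{pmatrix}0&\varphi(s)I_{2^{n-1}}\\ \varphi(s)I_{2^{n-1}}&0\end{pmatrix},$$ and $$\sigma(\mathcal{H})=\mathrm{cl}\bigl(-\varphi(\mathbb{R}^n)\cup\varphi(\mathbb{R}^n)\bigr),\qquad \|\mathcal{H}\|=\sup_{s\in\mathbb{R}^n}|\varphi(s)|.$$ -/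

import Mathlib

open MeasureTheory

noncomputable section

namespace HausdorffOp

/-- The Hilbert space `L²(ℝⁿ)` of complex-valued functions. Here `ℝⁿ` is `Fin n → ℝ` with its
Lebesgue measure; the choice of a norm on `ℝⁿ` plays no role. -/
abbrev L2 (n : ℕ) : Type := Lp ℂ 2 (volume : Measure (Fin n → ℝ))

/-- `T` is the Hausdorff operator `(T f)(x) = ∫ K(u) f(A(u) x) dμ(u)` on `L²(ℝⁿ)`: for every `f`,
the integral converges absolutely for almost every `x` and is equal to `(T f)(x)` for almost
every `x`. -/
def IsHausdorffOperator {Ω : Type*} [MeasurableSpace Ω] (μ : Measure Ω) {n : ℕ} (K : Ω → ℂ)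
    (A : Ω → Matrix (Fin n) (Fin n) ℝ) (T : L2 n →L[ℂ] L2 n) : Prop :=
  ∀ f : L2 n,
    (∀ᵐ x : Fin n → ℝ, Integrable (fun u => K u * f ((A u).mulVec x)) μ) ∧
    ∀ᵐ x : Fin n → ℝ, T f x = ∫ u, K u * f ((A u).mulVec x) ∂μ

/-- An orthogonal matrix `C` and a family of vectors `a(u)` such that
`diag(a₁(u), …, aₙ(u)) = C⁻¹ A(u) C` for all `u`. -/
def IsDiagonalization {Ω : Type*} {n : ℕ} (A : Ω → Matrix (Fin n) (Fin n) ℝ)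
    (C : Matrix (Fin n) (Fin n) ℝ) (a : Ω → Fin n → ℝ) : Prop :=
  C ∈ Matrix.orthogonalGroup (Fin n) ℝ ∧ ∀ u, Matrix.diagonal (a u) = C⁻¹ * A u * C

/-- Coordinate-wise multiplication by a vector of signs. -/
def signMul {n : ℕ} (ε : Fin n → ℤˣ) (x : Fin n → ℝ) : Fin n → ℝ :=
  fun k => ((ε k : ℤ) : ℝ) * x k

/-- The family of all open hyperoctants of `ℝⁿ`. -/
def hyperoctants (n : ℕ) : Set (Set (Fin n → ℝ)) :=
  Set.range fun ε : Fin n → ℤˣ => {x | ∀ k, 0 < signMul ε x k}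

/-- The set `Ω_{ij}` of those `u` for which the vector of signs of `a(u)` is the (unique)
`ε(i; j) ∈ {-1, 1}ⁿ` with `ε(i; j) U_i = U_j`. -/
def signSet {Ω : Type*} {n : ℕ} (a : Ω → Fin n → ℝ) (U : Fin (2 ^ n) ≃ hyperoctants n)
    (i j : Fin (2 ^ n)) : Set Ω :=
  {u | ∃ ε : Fin n → ℤˣ, signMul ε '' (U i : Set (Fin n → ℝ)) = (U j : Set (Fin n → ℝ)) ∧
    ∀ k, Real.sign (a u k) = ((ε k : ℤ) : ℝ)}

/-- `|a|^{-1/2 - i s} = ∏ₖ exp((-1/2 - i sₖ) log |aₖ|)`. -/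
def absPow {n : ℕ} (a s : Fin n → ℝ) : ℂ :=
  ∏ k, Complex.exp ((-(1 / 2) - Complex.I * (s k : ℂ)) * (Real.log |a k| : ℂ))

/-- The matrix symbol: `Φ(s)_{ij} = ∫_{Ω_{ij}} K(u) |a(u)|^{-1/2 - i s} dμ(u)`. -/
def matrixSymbol {Ω : Type*} [MeasurableSpace Ω] (μ : Measure Ω) {n : ℕ} (K : Ω → ℂ)
    (a : Ω → Fin n → ℝ) (U : Fin (2 ^ n) ≃ hyperoctants n) (s : Fin n → ℝ) :
    Matrix (Fin (2 ^ n)) (Fin (2 ^ n)) ℂ :=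
  Matrix.of fun i j => ∫ u in signSet a U i j, K u * absPow (a u) s ∂μ

/-- The scalar function `φ(s) = ∫_Ω K(u) |a(u)|^{-1/2 - i s} dμ(u)`. -/
def scalarSymbol {Ω : Type*} [MeasurableSpace Ω] (μ : Measure Ω) {n : ℕ} (K : Ω → ℂ)
    (a : Ω → Fin n → ℝ) (s : Fin n → ℝ) : ℂ :=
  ∫ u, K u * absPow (a u) s ∂μ

/-- The index set `{0, …, 2ⁿ - 1}` split into its first half and its second half, in order. -/
def halves {n : ℕ} (hn : n ≠ 0) : Fin (2 ^ (n - 1)) ⊕ Fin (2 ^ (n - 1)) ≃ Fin (2 ^ n) :=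
  finSumFinEquiv.trans (finCongr (by rw [← two_mul, mul_pow_sub_one hn]))

end HausdorffOp

end

/-! Let `C` diagonalize all `A u` at once; the eigenvalues `a u k` are negative. On the hyperoctant
with signs `ε` put `x = C (εₖ exp tₖ)ₖ` and multiply functions by `exp (∑ tₖ / 2)`. This identifies
`L²(ℝⁿ)` unitarily with the `L²` functions of `t` valued in a space with one component per
hyperoctant (`logUnitary`). The normalized dilation `|det A|^{1/2} f (A x)` becomes the translation
by `log |a|` followed by the exchange `J` of antipodal hyperoctants (`logFun_dilate`).

The Fourier transform makes translations into multiplications by characters (`fourierL2_translate`).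
Integrating these against the `L¹` kernel `|det A|^{-1/2} K` shows that the operator is unitarily
equivalent to `M J`, where `M` multiplies by `m ξ = φ (-2πξ)`. This equivalence is proved weakly, by
Fubini (`inner_symbolOp`), and the pointwise formula follows by testing on indicators
(`isHausdorffOperator_symbolOp`).

`J` is an involution that commutes with `M` and has both eigenvalues `1` and `-1`, so the spectrum
of `M J` is the closure of the values `±m` (`spectrum_mulOp_comp`). The norm is at most `sup |m|`
pointwise and at least that by the spectrum.

For the matrix symbol, only the sign vector `-1` occurs: `Ω_{ij}` is `Ω` if `U_j = -U_i` and is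
empty otherwise. It remains to list the hyperoctants with antipodes half the range apart. -/

noncomputable section

namespace HausdorffOp

/-! ### Multiplication operators composed with an involution, and their spectrum -/

section Multiplication

open scoped BoundedContinuousFunction ENNReal

variable {X F : Type*} [TopologicalSpace X] [MeasurableSpace X] [OpensMeasurableSpace X]
  {ν : Measure X} [NormedAddCommGroup F] [NormedSpace ℂ F]

theorem memLp_boundedContinuous_smul (m : X →ᵇ ℂ) (g : Lp F 2 ν) :
    MemLp (fun x => m x • g x) 2 ν :=
  (Lp.memLp g).smul (memLp_top_of_bound m.continuous.aestronglyMeasurable ‖m‖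
    (.of_forall m.norm_coe_le_norm) : MemLp m ∞ ν)

/-- Multiplication by a bounded continuous function, as an operator on `L²`. -/
def mulOp (ν : Measure X) (F : Type*) [NormedAddCommGroup F] [NormedSpace ℂ F] (m : X →ᵇ ℂ) :
    Lp F 2 ν →L[ℂ] Lp F 2 ν :=
  LinearMap.mkContinuous
    { toFun := fun g => (memLp_boundedContinuous_smul m g).toLp _
      map_add' := fun g h => by
        rw [← MemLp.toLp_add]
        apply MemLp.toLp_congr
        filter_upwards [Lp.coeFn_add g h] with x hx
        rw [hx, Pi.add_apply, Pi.add_apply, smul_add]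
      map_smul' := fun c g => by
        rw [RingHom.id_apply, ← MemLp.toLp_const_smul]
        apply MemLp.toLp_congr
        filter_upwards [Lp.coeFn_smul c g] with x hx
        rw [hx, Pi.smul_apply, Pi.smul_apply, smul_comm] } ‖m‖ fun g => by
    refine Lp.norm_le_mul_norm_of_ae_le_mul ?_
    filter_upwards [(memLp_boundedContinuous_smul m g).coeFn_toLp] with x hx
    simp only [LinearMap.coe_mk, AddHom.coe_mk]
    rw [hx, norm_smul]
    gcongr
    exact m.norm_coe_le_norm x

theorem coeFn_mulOp (m : X →ᵇ ℂ) (g : Lp F 2 ν) :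
    mulOp ν F m g =ᵐ[ν] fun x => m x • g x :=
  (memLp_boundedContinuous_smul m g).coeFn_toLp

theorem mulOp_mul (m₁ m₂ : X →ᵇ ℂ) : mulOp ν F (m₁ * m₂) = mulOp ν F m₁ * mulOp ν F m₂ := by
  ext1 g
  apply Lp.ext
  filter_upwards [coeFn_mulOp (m₁ * m₂) g, coeFn_mulOp m₂ g, coeFn_mulOp m₁ (mulOp ν F m₂ g)]
    with x h1 h2 h3
  rw [h1, mul_apply_eq_comp, h3, h2, BoundedContinuousFunction.mul_apply, mul_smul]

theorem mulOp_add (m₁ m₂ : X →ᵇ ℂ) : mulOp ν F (m₁ + m₂) = mulOp ν F m₁ + mulOp ν F m₂ := by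
  ext1 g
  apply Lp.ext
  filter_upwards [coeFn_mulOp (m₁ + m₂) g, coeFn_mulOp m₂ g, coeFn_mulOp m₁ g,
    Lp.coeFn_add (mulOp ν F m₁ g) (mulOp ν F m₂ g)] with x h1 h2 h3 h4
  rw [h1, BoundedContinuousFunction.add_apply, add_smul, _root_.add_apply, h4, Pi.add_apply, h3, h2]

theorem mulOp_const (c : ℂ) :
    mulOp ν F (BoundedContinuousFunction.const X c) = algebraMap ℂ _ c := by
  ext1 g
  apply Lp.ext
  filter_upwards [coeFn_mulOp (BoundedContinuousFunction.const X c) g, Lp.coeFn_smul c g]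
    with x h1 h2
  rw [h1, Algebra.algebraMap_eq_smul_one, smul_apply,
    one_apply_eq_self, h2]
  simp

theorem mulOp_comm_compLpL (m : X →ᵇ ℂ) (J : F →L[ℂ] F) :
    Commute (mulOp ν F m) (J.compLpL 2 ν) := by
  ext1 g
  apply Lp.ext
  filter_upwards [coeFn_mulOp m (J.compLpL 2 ν g), coeFn_mulOp m g, J.coeFn_compLpL (p := 2) g,
    J.coeFn_compLpL (p := 2) (mulOp ν F m g)] with x h1 h2 h3 h4
  rw [mul_apply_eq_comp, mul_apply_eq_comp, h1, h3, h4, h2, map_smul]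

theorem norm_mulOp_comp_le (m : X →ᵇ ℂ) {J : F →L[ℂ] F} (hJ : ∀ v, ‖J v‖ ≤ ‖v‖) {c : ℝ}
    (hc : 0 ≤ c) (hm : ∀ x, ‖m x‖ ≤ c) : ‖mulOp ν F m * J.compLpL 2 ν‖ ≤ c := by
  refine ContinuousLinearMap.opNorm_le_bound _ hc fun g => ?_
  refine Lp.norm_le_mul_norm_of_ae_le_mul ?_
  filter_upwards [coeFn_mulOp m (J.compLpL 2 ν g), J.coeFn_compLpL (p := 2) g] with x h1 h2
  rw [mul_apply_eq_comp, h1, h2, norm_smul]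
  exact mul_le_mul (hm x) (hJ _) (norm_nonneg _) hc

omit [TopologicalSpace X] [OpensMeasurableSpace X] in
theorem compLpL_involution {J : F →L[ℂ] F} (hJ : ∀ v, J (J v) = v) :
    J.compLpL 2 ν * J.compLpL 2 ν = 1 := by
  ext1 g
  apply Lp.ext
  filter_upwards [J.coeFn_compLpL (p := 2) g, J.coeFn_compLpL (p := 2) (J.compLpL 2 ν g)]
    with x h1 h2
  rw [mul_apply_eq_comp, h2, h1, hJ, one_apply_eq_self]

/-- The values `±m(x)` belong to the spectrum of multiplication by `m` composed with an involution
that has the corresponding eigenvector. -/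
theorem mem_spectrum_mulOp_comp [ν.IsOpenPosMeasure] [IsLocallyFiniteMeasure ν] (m : X →ᵇ ℂ)
    {J : F →L[ℂ] F} {c : ℂ} {v : F} (hv : v ≠ 0) (hJv : J v = c • v) (hc : ‖c‖ = 1) (x₀ : X) :
    c * m x₀ ∈ spectrum ℂ (mulOp ν F m * J.compLpL 2 ν) := by
  intro hu
  obtain ⟨S, hS⟩ := hu.exists_left_inv
  set T := mulOp ν F m * J.compLpL 2 ν with hT
  -- Chosen so that `‖S‖ * δ < 1`: a left inverse `S` is contradicted by a nonzero `g` that is an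
  -- eigenvector up to an error `δ * ‖g‖`.
  set δ : ℝ := (‖S‖ + 1)⁻¹ with hδ
  have hδ0 : 0 < δ := by positivity
  -- The approximate eigenvector is `v` on a small neighbourhood of `x₀`: finite measure puts it in
  -- `L²`, openness makes it nonzero, and `m` is within `δ` of `m x₀` there.
  obtain ⟨s, hs, hso, hxs⟩ : ∃ s : Set X, (s ⊆ {x | ‖m x₀ - m x‖ < δ} ∧ ν s < ∞) ∧
      IsOpen s ∧ x₀ ∈ s := by
    obtain ⟨t, ⟨hxt, hto⟩, ht⟩ := (ν.finiteAt_nhds x₀).exists_mem_basis (nhds_basis_opens x₀)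
    refine ⟨t ∩ {x | ‖m x₀ - m x‖ < δ}, ⟨Set.inter_subset_right,
      (measure_mono Set.inter_subset_left).trans_lt ht⟩, hto.inter ?_, hxt, by simpa using hδ0⟩
    exact isOpen_lt (by fun_prop) continuous_const
  have hms := hso.measurableSet
  set g : Lp F 2 ν := indicatorConstLp 2 hms hs.2.ne v with hg
  have hg0 : 0 < ‖g‖ := by
    rw [hg, norm_indicatorConstLp (by norm_num) (by norm_num)]
    have : 0 < ν.real s := by
      rw [Measure.real, ENNReal.toReal_pos_iff]
      exact ⟨hso.measure_pos ν ⟨x₀, hxs⟩, hs.2⟩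
    have := norm_pos_iff.mpr hv
    positivity
  have hle : ‖(algebraMap ℂ _ (c * m x₀) - T) g‖ ≤ δ * ‖g‖ := by
    refine Lp.norm_le_mul_norm_of_ae_le_mul ?_
    filter_upwards [coeFn_mulOp m (J.compLpL 2 ν g), J.coeFn_compLpL (p := 2) g,
      indicatorConstLp_coeFn (p := 2) (hs := hms) (hμs := hs.2.ne) (c := v),
      Lp.coeFn_sub ((c * m x₀) • g) (T g), Lp.coeFn_smul (c * m x₀) g] with x h1 h2 h3 h4 h5
    rw [Algebra.algebraMap_eq_smul_one, sub_apply,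
      smul_apply, one_apply_eq_self, h4, Pi.sub_apply, h5, hT,
      mul_apply_eq_comp, h1, h2, Pi.smul_apply, h3]
    by_cases hx : x ∈ s
    · rw [Set.indicator_of_mem hx, hJv, smul_smul, ← sub_smul, norm_smul, mul_comm (m x), ← mul_sub,
        norm_mul, hc, one_mul]
      gcongr
      exact (hs.1 hx).le
    · simp [Set.indicator_of_notMem hx]
  have h1 : g = S ((algebraMap ℂ _ (c * m x₀) - T) g) := by
    rw [← mul_apply_eq_comp, hS, one_apply_eq_self]
  have h2 : ‖g‖ ≤ ‖S‖ * (δ * ‖g‖) := by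
    calc ‖g‖ = ‖S ((algebraMap ℂ _ (c * m x₀) - T) g)‖ := congrArg _ h1
      _ ≤ ‖S‖ * ‖(algebraMap ℂ _ (c * m x₀) - T) g‖ := S.le_opNorm _
      _ ≤ _ := by gcongr
  have h3 : ‖S‖ * δ < 1 := by
    rw [hδ, ← div_eq_mul_inv, div_lt_one (by positivity)]
    linarith
  nlinarith

/-- A scalar at positive distance from the values `±m(x)` is not in the spectrum of multiplication
by `m` composed with an involution. -/
theorem notMem_spectrum_mulOp_comp (m : X →ᵇ ℂ) {J : F →L[ℂ] F} (hJ : ∀ v, J (J v) = v) {z : ℂ}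
    (hz : z ∉ closure (Set.range (fun x => -m x) ∪ Set.range m)) :
    z ∉ spectrum ℂ (mulOp ν F m * J.compLpL 2 ν) := by
  obtain ⟨δ, hδ, hball⟩ : ∃ δ > 0, ∀ w ∈ Set.range (fun x => -m x) ∪ Set.range m, δ ≤ ‖z - w‖ := by
    rw [Metric.mem_closure_iff] at hz
    push Not at hz
    simpa [dist_eq_norm] using hz
  have hlow : ∀ x, δ * δ ≤ ‖z ^ 2 - m x ^ 2‖ := fun x => by
    have h1 := hball (m x) (.inr ⟨x, rfl⟩)
    have h2 := hball (-m x) (.inl ⟨x, rfl⟩)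
    rw [sq_sub_sq, norm_mul, ← sub_neg_eq_add]
    gcongr
  have hne : ∀ x, z ^ 2 - m x ^ 2 ≠ 0 := fun x h => by
    have := hlow x
    rw [h, norm_zero] at this
    nlinarith
  -- Since `(M * P)² = M²`, the inverse of `z - M * P` is `(z² - M²)⁻¹ * (z + M * P)`; the distance
  -- from `z` to the values `±m x` keeps `(z² - m²)⁻¹` bounded.
  let r : X →ᵇ ℂ := BoundedContinuousFunction.ofNormedAddCommGroup
    (fun x => (z ^ 2 - m x ^ 2)⁻¹) (by fun_prop (disch := exact hne)) (δ * δ)⁻¹ fun x => by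
      rw [norm_inv]
      gcongr
      exact hlow x
  set M := mulOp ν F m
  set P := J.compLpL 2 ν
  have hMP : Commute M P := mulOp_comm_compLpL m J
  have hPP : P * P = 1 := compLpL_involution hJ
  have hr : mulOp ν F r * (algebraMap ℂ _ (z ^ 2) - M * M) = 1 := by
    have : r * (BoundedContinuousFunction.const X (z ^ 2) + (-1 : ℂ) • (m * m)) =
        BoundedContinuousFunction.const X 1 := by
      ext x
      have := inv_mul_cancel₀ (hne x)
      simpa [r, sub_eq_add_neg, sq] using this
    have h2 := congrArg (mulOp ν F) this
    have h3 : mulOp ν F ((-1 : ℂ) • (m * m)) = -(M * M) := by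
      have : (-1 : ℂ) • (m * m) = BoundedContinuousFunction.const X (-1) * (m * m) := by
        ext x; simp
      rw [this, mulOp_mul, mulOp_mul, mulOp_const]
      simp [M]
    rw [mulOp_mul, mulOp_add, mulOp_const, mulOp_const, h3, map_one] at h2
    rw [sub_eq_add_neg, h2]
  have hRcomm : Commute (mulOp ν F r) M := by
    rw [commute_iff_eq, ← mulOp_mul, ← mulOp_mul, mul_comm]
  have hRP : Commute (mulOp ν F r) P := mulOp_comm_compLpL r J
  rw [spectrum.notMem_iff]
  set Z := algebraMap ℂ (Lp F 2 ν →L[ℂ] Lp F 2 ν) z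
  have hZ : ∀ S : Lp F 2 ν →L[ℂ] Lp F 2 ν, Commute Z S := Algebra.commutes z
  have hsq : (Z + M * P) * (Z - M * P) = algebraMap ℂ _ (z ^ 2) - M * M := by
    have h1 : (M * P) * (M * P) = M * M := by
      rw [mul_assoc, ← mul_assoc P, ← hMP.eq, mul_assoc M P P, hPP, mul_one]
    rw [add_mul, mul_sub, mul_sub, h1, (hZ (M * P)).eq, map_pow, sq]
    abel
  have hcom : Commute (mulOp ν F r * (Z + M * P)) (Z - M * P) := by
    have hRMP : Commute (mulOp ν F r) (M * P) := hRcomm.mul_right hRP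
    refine Commute.mul_left ?_ ?_
    · exact ((hZ _).symm).sub_right hRMP
    · exact ((Commute.refl Z).sub_right (hZ _)).add_left
        ((hZ _).symm.sub_right (Commute.refl _))
  have hinv : mulOp ν F r * (Z + M * P) * (Z - M * P) = 1 := by rw [mul_assoc, hsq, hr]
  exact ⟨⟨Z - M * P, mulOp ν F r * (Z + M * P), by rw [← hcom.eq, hinv], hinv⟩, rfl⟩

/-- Both eigenvectors of `J` are needed: `v` yields the values `m x` and `w` the values `-m x`. The
closure comes for free because the spectrum is closed. -/
theorem spectrum_mulOp_comp [ν.IsOpenPosMeasure] [IsLocallyFiniteMeasure ν] [CompleteSpace F]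
    (m : X →ᵇ ℂ) {J : F →L[ℂ] F} (hJ : ∀ v, J (J v) = v) {v w : F} (hv : v ≠ 0) (hJv : J v = v)
    (hw : w ≠ 0) (hJw : J w = -w) :
    spectrum ℂ (mulOp ν F m * J.compLpL 2 ν) =
      closure (Set.range (fun x => -m x) ∪ Set.range m) := by
  refine Set.Subset.antisymm (fun z hz => ?_) ?_
  · by_contra h
    exact notMem_spectrum_mulOp_comp m hJ h hz
  · refine closure_minimal (Set.union_subset ?_ ?_) (spectrum.isClosed _)
    · rintro _ ⟨x, rfl⟩
      simpa using mem_spectrum_mulOp_comp (ν := ν) m (c := -1) hw (by simpa using hJw) (by simp) x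
    · rintro _ ⟨x, rfl⟩
      simpa using mem_spectrum_mulOp_comp (ν := ν) m (c := 1) hv (by simpa using hJv) (by simp) x

end Multiplication

/-! ### Simultaneous orthogonal diagonalization -/

section Diagonalization

open Module.End

variable {Ω : Type*} {n : ℕ}

/-- The joint eigenspaces, indexed by all `γ : Ω → ℝ`, form an orthogonal direct sum. `Ω` may be
infinite, but independence leaves only finitely many nonzero summands, and a basis subordinate to
these works. -/
theorem exists_orthonormalBasis_eigenvectors {E : Type*} [NormedAddCommGroup E]
    [InnerProductSpace ℝ E] [FiniteDimensional ℝ E] (hE : Module.finrank ℝ E = n)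
    (T : Ω → E →ₗ[ℝ] E) (hT : ∀ u, (T u).IsSymmetric) (hcomm : ∀ u v, Commute (T u) (T v)) :
    ∃ (b : OrthonormalBasis (Fin n) ℝ E) (a : Ω → Fin n → ℝ), ∀ u k, T u (b k) = a u k • b k := by
  classical
  have hI := LinearMap.IsSymmetric.directSum_isInternal_of_pairwise_commute hT
    fun u v _ => hcomm u v
  have hO := LinearMap.IsSymmetric.orthogonalFamily_iInf_eigenspaces hT
  have hfin := WellFoundedGT.finite_ne_bot_of_iSupIndep hO.independent
  let V : {γ : Ω → ℝ // (⨅ u, eigenspace (T u) (γ u)) ≠ ⊥} → Submodule ℝ E :=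
    fun γ => ⨅ u, eigenspace (T u) (γ.1 u)
  have : Fintype {γ : Ω → ℝ // (⨅ u, eigenspace (T u) (γ u)) ≠ ⊥} := hfin.fintype
  have hV : DirectSum.IsInternal V := DirectSum.isInternal_ne_bot_iff.mpr hI
  have hVO : OrthogonalFamily ℝ (fun γ => V γ) fun γ => (V γ).subtypeₗᵢ :=
    hO.comp Subtype.val_injective
  refine ⟨hV.subordinateOrthonormalBasis hE hVO,
    fun u k => (hV.subordinateOrthonormalBasisIndex hE k hVO).1 u, fun u k => ?_⟩
  have h := hV.subordinateOrthonormalBasis_subordinate hE k hVO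
  exact mem_eigenspace_iff.mp ((Submodule.mem_iInf _).mp h u)

theorem exists_isDiagonalization (A : Ω → Matrix (Fin n) (Fin n) ℝ)
    (hcomm : ∀ u v, Commute (A u) (A v)) (hA : ∀ u, (A u).IsHermitian) :
    ∃ C a, IsDiagonalization A C a := by
  obtain ⟨b, a, hb⟩ := exists_orthonormalBasis_eigenvectors (n := n)
    (E := EuclideanSpace ℝ (Fin n)) (by simp)
    (fun u => (A u).toEuclideanLin) (fun u => Matrix.isSymmetric_toEuclideanLin_iff.mpr (hA u))
    fun u v => by
      rw [commute_iff_eq]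
      ext1 x
      have := congrArg (fun M => WithLp.toLp 2 (M.mulVec (WithLp.ofLp x))) (hcomm u v).eq
      simpa [Matrix.toLpLin_apply, Module.End.mul_apply] using this
  set C := (EuclideanSpace.basisFun (Fin n) ℝ).toBasis.toMatrix b with hC
  have hCo : C ∈ Matrix.orthogonalGroup (Fin n) ℝ :=
    (EuclideanSpace.basisFun (Fin n) ℝ).toMatrix_orthonormalBasis_mem_unitary b
  have hCe : ∀ i j, C i j = b j i := fun i j => by simp [hC, Module.Basis.toMatrix_apply]
  have hdet : IsUnit C.det :=
    (Matrix.isUnit_iff_isUnit_det _).mp (Unitary.toUnits ⟨C, hCo⟩).isUnit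
  refine ⟨C, a, hCo, fun u => ?_⟩
  have : A u * C = C * Matrix.diagonal (a u) := by
    ext i j
    have := congrArg (fun x : EuclideanSpace ℝ (Fin n) => x i) (hb u j)
    simp only [Matrix.toLpLin_apply, PiLp.smul_apply, smul_eq_mul] at this
    rw [Matrix.mul_diagonal, hCe, mul_comm, ← this]
    simp [Matrix.mul_apply, Matrix.mulVec, dotProduct, hCe]
  rw [mul_assoc, this, Matrix.nonsing_inv_mul_cancel_left _ _ hdet]

namespace IsDiagonalization

variable {A : Ω → Matrix (Fin n) (Fin n) ℝ} {C : Matrix (Fin n) (Fin n) ℝ} {a : Ω → Fin n → ℝ}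

theorem inv_eq (h : IsDiagonalization A C a) : C⁻¹ = C.transpose :=
  Matrix.inv_eq_left_inv ((Matrix.mem_orthogonalGroup_iff' _ _).mp h.1)

theorem isUnit_det (h : IsDiagonalization A C a) : IsUnit C.det :=
  (Matrix.isUnit_iff_isUnit_det _).mp (Unitary.toUnits ⟨C, h.1⟩).isUnit

theorem mul_eq (h : IsDiagonalization A C a) (u : Ω) : A u * C = C * Matrix.diagonal (a u) := by
  rw [h.2 u, ← mul_assoc, ← mul_assoc, Matrix.mul_nonsing_inv _ h.isUnit_det, one_mul]

theorem det_eq (h : IsDiagonalization A C a) (u : Ω) : (A u).det = ∏ k, a u k := by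
  rw [← Matrix.det_diagonal, h.2 u, Matrix.det_mul_comm, ← mul_assoc,
    Matrix.mul_nonsing_inv _ h.isUnit_det, one_mul]

theorem neg_of_posDef (h : IsDiagonalization A C a) {u : Ω} (hA : (-(A u)).PosDef) (k : Fin n) :
    a u k < 0 := by
  have h1 : (-(Matrix.diagonal (a u))).PosDef := by
    have := hA.conjTranspose_mul_mul_same (B := C)
      (Matrix.mulVec_injective_of_isUnit ((Matrix.isUnit_iff_isUnit_det _).mpr h.isUnit_det))
    rw [Matrix.conjTranspose_eq_transpose_of_trivial, ← h.inv_eq] at this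
    rw [h.2 u]
    simpa using this
  rw [Matrix.diagonal_neg, Matrix.posDef_diagonal_iff] at h1
  simpa using h1 k

/-- Each eigenvalue is a fixed linear combination of the entries of `A u`, which makes it measurable
in `u`. -/
theorem entry_eq (h : IsDiagonalization A C a) (u : Ω) (k : Fin n) :
    a u k = ∑ i, ∑ j, C i k * A u i j * C j k := by
  have := congrFun (congrFun (h.2 u) k) k
  rw [Matrix.diagonal_apply_eq, h.inv_eq] at this
  rw [this, Matrix.mul_apply, Finset.sum_comm]
  simp [Matrix.mul_apply, Finset.sum_mul]

end IsDiagonalization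

end Diagonalization

/-! ### Sign vectors, hyperoctants and the block form of the matrix symbol -/

section Enumeration

variable {n : ℕ}

/-- The open hyperoctant with signs `ε`. -/
def octant (ε : Fin n → ℤˣ) : Set (Fin n → ℝ) := {x | ∀ k, 0 < signMul ε x k}

theorem signMul_signMul (ε δ : Fin n → ℤˣ) (x : Fin n → ℝ) :
    signMul ε (signMul δ x) = signMul (ε * δ) x := by
  funext k
  simp [signMul, mul_assoc]

@[simp]
theorem signMul_one (x : Fin n → ℝ) : signMul 1 x = x := by
  funext k
  simp [signMul]

theorem mul_self_sign (ε : Fin n → ℤˣ) : ε * ε = 1 := by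
  funext k
  exact Int.units_mul_self (ε k)

theorem signMul_image_octant (ε δ : Fin n → ℤˣ) : signMul ε '' octant δ = octant (ε * δ) := by
  ext x
  constructor
  · rintro ⟨y, hy, rfl⟩ k
    rw [signMul_signMul, mul_right_comm, mul_self_sign, one_mul]
    exact hy k
  · intro hx
    refine ⟨signMul ε x, fun k => ?_, ?_⟩
    · rw [signMul_signMul, mul_comm]
      exact hx k
    · rw [signMul_signMul, mul_self_sign, signMul_one]

theorem octant_injective : Function.Injective (octant (n := n)) := by
  intro ε δ h
  have hx : signMul ε 1 ∈ octant ε := fun k => by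
    rw [signMul_signMul, mul_self_sign, signMul_one]
    exact one_pos
  rw [h] at hx
  funext k
  have := hx k
  rcases Int.units_eq_one_or (ε k) with h1 | h1 <;> rcases Int.units_eq_one_or (δ k) with h2 | h2
    <;> simp_all [signMul] <;> norm_num at this

/-- The hyperoctants are in bijection with the sign vectors. -/
def octantEquiv (n : ℕ) : (Fin n → ℤˣ) ≃ hyperoctants n := Equiv.ofInjective octant octant_injective

@[simp]
theorem coe_octantEquiv (ε : Fin n → ℤˣ) : (octantEquiv n ε : Set (Fin n → ℝ)) = octant ε := rfl

/-- Every sign vector is, up to sign, one whose `k`-th sign is positive. -/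
def signEquiv (k : Fin n) :
    {ε : Fin n → ℤˣ // ε k = 1} ⊕ {ε : Fin n → ℤˣ // ε k = 1} ≃ (Fin n → ℤˣ) where
  toFun := Sum.elim (fun ε => ε.1) fun ε => -ε.1
  invFun ε := if h : ε k = 1 then .inl ⟨ε, h⟩ else
    .inr ⟨-ε, by simp [(Int.units_eq_one_or (ε k)).resolve_left h]⟩
  left_inv := by
    rintro (⟨ε, h⟩ | ⟨ε, h⟩)
    · simp [h]
    · have : ¬ (-1 : ℤˣ) = 1 := by decide
      simp [h, this]
  right_inv ε := by
    by_cases h : ε k = 1 <;> simp [h]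

theorem card_sign_eq_one (k : Fin n) :
    Fintype.card {ε : Fin n → ℤˣ // ε k = 1} = 2 ^ (n - 1) := by
  have h := Fintype.card_congr (signEquiv k)
  rw [Fintype.card_sum, Fintype.card_fun, Fintype.card_fin,
    show Fintype.card ℤˣ = 2 from by decide, ← two_mul, ← mul_pow_sub_one (by
      rintro rfl; exact k.elim0 : n ≠ 0)] at h
  exact Nat.eq_of_mul_eq_mul_left two_pos h

/-- There is an enumeration of sign vectors in which antipodal vectors are half the range apart. -/
theorem exists_sign_enumeration (hn : n ≠ 0) : ∃ σ : Fin (2 ^ n) ≃ (Fin n → ℤˣ), ∀ x y,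
    σ (halves hn y) = -σ (halves hn x) ↔ y = x.swap := by
  let k : Fin n := ⟨0, Nat.pos_of_ne_zero hn⟩
  let e := (Fintype.equivFinOfCardEq (card_sign_eq_one k)).symm
  refine ⟨(halves hn).symm.trans ((Equiv.sumCongr e e).trans (signEquiv k)), ?_⟩
  have hd : ∀ i j, (e i).1 ≠ -(e j).1 := fun i j h => by
    have := congrFun h k
    rw [Pi.neg_apply, (e i).2, (e j).2] at this
    exact absurd this (by decide)
  have hd' : ∀ i j, -(e i).1 ≠ (e j).1 := fun i j h => hd j i h.symm
  have hinj : ∀ i j, (e i).1 = (e j).1 ↔ i = j := fun i j => by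
    rw [Subtype.val_inj, e.injective.eq_iff]
  rintro (i | i) (j | j) <;> simp [signEquiv, hd, hd', hinj]

/-- Negative eigenvalues leave `-1` as the only possible sign vector, so membership in `signSet`
depends on neither `u` nor `a`. Hence `U` can be fixed before the diagonalization. -/
theorem exists_hyperoctant_enumeration (hn : n ≠ 0) : ∃ U : Fin (2 ^ n) ≃ hyperoctants n,
    ∀ {Ω : Type*} (a : Ω → Fin n → ℝ), (∀ u k, a u k < 0) → ∀ x y,
      signSet a U (halves hn x) (halves hn y) = if y = x.swap then Set.univ else ∅ := by
  obtain ⟨σ, hσ⟩ := exists_sign_enumeration hn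
  refine ⟨σ.trans (octantEquiv n), fun a ha x y => ?_⟩
  have key : ∀ u, u ∈ signSet a (σ.trans (octantEquiv n))
      (halves hn x) (halves hn y) ↔ y = x.swap := by
    intro u
    rw [← hσ, signSet, Set.mem_ofPred_eq]
    simp only [Equiv.trans_apply, coe_octantEquiv, signMul_image_octant,
      octant_injective.eq_iff, Real.sign_of_neg (ha u _)]
    constructor
    · rintro ⟨ε, h1, h2⟩
      have : ε = -1 := by
        funext k
        rcases Int.units_eq_one_or (ε k) with h | h
        · have := h2 k
          rw [h] at this
          norm_num at this
        · simp [h]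
      rw [← h1, this, neg_one_mul]
    · intro h
      exact ⟨-1, by rw [h, neg_one_mul], fun k => by simp⟩
  ext u
  rw [key]
  split_ifs with h <;> simp [h]

theorem matrixSymbol_eq {Ω : Type*} [MeasurableSpace Ω] (μ : Measure Ω) (hn : n ≠ 0) (K : Ω → ℂ)
    (a : Ω → Fin n → ℝ) {U : Fin (2 ^ n) ≃ hyperoctants n}
    (hU : ∀ x y, signSet a U (halves hn x) (halves hn y) = if y = x.swap then Set.univ else ∅)
    (s : Fin n → ℝ) :
    matrixSymbol μ K a U s = Matrix.reindex (halves hn) (halves hn)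
      (Matrix.fromBlocks 0 (scalarSymbol μ K a s • 1) (scalarSymbol μ K a s • 1) 0) := by
  rw [← Equiv.symm_apply_eq, Matrix.reindex_symm]
  ext x y
  rw [Matrix.reindex_apply, Matrix.submatrix_apply]
  simp only [Equiv.symm_symm, matrixSymbol, Matrix.of_apply, hU]
  rcases x with i | i <;> rcases y with j | j
  all_goals
    simp only [Sum.swap_inl, Sum.swap_inr, reduceCtorEq, if_false, Measure.restrict_empty,
      integral_zero_measure, Matrix.fromBlocks_apply₁₁, Matrix.fromBlocks_apply₂₂,
      Matrix.fromBlocks_apply₁₂, Matrix.fromBlocks_apply₂₁, Matrix.zero_apply, Sum.inl.injEq,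
      Sum.inr.injEq, Matrix.smul_apply, Matrix.one_apply]
  all_goals
    by_cases h : i = j
    · subst h
      simp [scalarSymbol]
    · simp [h, Ne.symm h]

end Enumeration

/-! ### Logarithmic coordinates as a unitary map -/

section LogCoordinates

open scoped ENNReal

variable {n : ℕ}

/-- The chart `t ↦ (εₖ exp tₖ)ₖ` of the hyperoctant with signs `ε`. -/
def expSign (ε : Fin n → ℤˣ) (t : Fin n → ℝ) : Fin n → ℝ := signMul ε fun k => Real.exp (t k)

theorem abs_sign (ε : ℤˣ) : |((ε : ℤ) : ℝ)| = 1 := by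
  rcases Int.units_eq_one_or ε with h | h <;> simp [h]

theorem log_abs_expSign (ε : Fin n → ℤˣ) (t : Fin n → ℝ) (k : Fin n) :
    Real.log |expSign ε t k| = t k := by
  simp [expSign, signMul, abs_mul, abs_sign]

theorem expSign_mem_octant {ε δ : Fin n → ℤˣ} {t : Fin n → ℝ} :
    expSign ε t ∈ octant δ ↔ ε = δ := by
  have h : expSign ε t ∈ octant ε := fun k => by
    rw [expSign, signMul_signMul, mul_self_sign, signMul_one]
    exact Real.exp_pos _
  refine ⟨fun h' => ?_, fun h' => h' ▸ h⟩
  funext k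
  have h1 := h k
  have h2 := h' k
  rcases Int.units_eq_one_or (ε k) with h3 | h3 <;> rcases Int.units_eq_one_or (δ k) with h4 | h4
    <;> simp_all [signMul] <;> linarith

theorem expSign_injective (ε : Fin n → ℤˣ) : Function.Injective (expSign ε) := fun s t h => by
  funext k
  rw [← log_abs_expSign ε s k, h, log_abs_expSign]

theorem expSign_image (ε : Fin n → ℤˣ) : expSign ε '' Set.univ = octant ε := by
  ext x
  constructor
  · rintro ⟨t, -, rfl⟩
    exact expSign_mem_octant.mpr rfl
  · intro hx
    refine ⟨fun k => Real.log (signMul ε x k), trivial, ?_⟩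
    have : (fun k => Real.exp (Real.log (signMul ε x k))) = signMul ε x :=
      funext fun k => Real.exp_log (hx k)
    rw [expSign, this, signMul_signMul, mul_self_sign, signMul_one]

theorem measurable_expSign (ε : Fin n → ℤˣ) : Measurable (expSign ε) := by
  unfold expSign signMul
  fun_prop

theorem measurableSet_octant (ε : Fin n → ℤˣ) : MeasurableSet (octant ε) := by
  have : octant ε = ⋂ k, {x | 0 < signMul ε x k} := by
    ext x
    simp [octant]
  rw [this]
  refine MeasurableSet.iInter fun k => measurableSet_lt measurable_const ?_
  unfold signMul
  fun_prop

/-- Change of variables: the derivative of the chart is diagonal with entries `εₖ exp tₖ`. -/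
theorem lintegral_octant (ε : Fin n → ℤˣ) (g : (Fin n → ℝ) → ℝ≥0∞) :
    ∫⁻ x in octant ε, g x =
      ∫⁻ t : Fin n → ℝ, ENNReal.ofReal (Real.exp (∑ k, t k)) * g (expSign ε t) := by
  let D : (Fin n → ℝ) → (Fin n → ℝ) →L[ℝ] (Fin n → ℝ) := fun t =>
    ContinuousLinearMap.pi fun k =>
      (((ε k : ℤ) : ℝ) * Real.exp (t k)) • ContinuousLinearMap.proj (R := ℝ) k
  have hD : ∀ t ∈ Set.univ, HasFDerivWithinAt (expSign ε) (D t) Set.univ t := by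
    intro t _
    rw [hasFDerivWithinAt_univ, hasFDerivAt_pi]
    intro k
    have := ((hasFDerivAt_apply (𝕜 := ℝ) k t).exp).const_mul ((ε k : ℤ) : ℝ)
    simpa [D, expSign, signMul, smul_smul] using this
  have hdet : ∀ t, |(D t).det| = Real.exp (∑ k, t k) := by
    intro t
    have : ((D t : (Fin n → ℝ) →L[ℝ] (Fin n → ℝ)) : (Fin n → ℝ) →ₗ[ℝ] (Fin n → ℝ)) =
        Matrix.toLin' (Matrix.diagonal fun k => ((ε k : ℤ) : ℝ) * Real.exp (t k)) := by
      ext x k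
      simp [D, Matrix.mulVec_diagonal]
    rw [ContinuousLinearMap.det, this, LinearMap.det_toLin', Matrix.det_diagonal,
      Finset.abs_prod, Real.exp_sum]
    simp [abs_mul, abs_sign]
  have h := lintegral_image_eq_lintegral_abs_det_fderiv_mul volume MeasurableSet.univ hD
    (expSign_injective ε).injOn g
  rw [expSign_image, Measure.restrict_univ] at h
  simpa only [hdet] using h

theorem iUnion_octant_ae_eq : (⋃ ε : Fin n → ℤˣ, octant ε) =ᵐ[volume] Set.univ := by
  rw [ae_eq_univ]
  refine measure_mono_null (t := ⋃ k, {x : Fin n → ℝ | x k = 0}) (fun x hx => ?_)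
    (measure_iUnion_null fun k => Measure.pi_hyperplane _ k 0)
  by_contra h
  simp only [Set.mem_iUnion, Set.mem_ofPred_eq, not_exists] at h
  refine hx (Set.mem_iUnion.mpr ⟨fun k => if 0 < x k then 1 else -1, fun k => ?_⟩)
  rcases lt_trichotomy (x k) 0 with h1 | h1 | h1
  · simp [signMul, h1.not_gt, h1]
  · exact absurd h1 (h k)
  · simp [signMul, h1]

theorem lintegral_eq_sum_octant (g : (Fin n → ℝ) → ℝ≥0∞) :
    ∫⁻ x, g x = ∑ ε : Fin n → ℤˣ,
      ∫⁻ t : Fin n → ℝ, ENNReal.ofReal (Real.exp (∑ k, t k)) * g (expSign ε t) := by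
  rw [← setLIntegral_univ, ← setLIntegral_congr iUnion_octant_ae_eq,
    lintegral_iUnion measurableSet_octant, tsum_fintype]
  · simp_rw [lintegral_octant]
  · intro ε δ h
    refine Set.disjoint_left.mpr fun x hx hx' => ?_
    rw [← expSign_image] at hx
    obtain ⟨t, -, rfl⟩ := hx
    exact h (expSign_mem_octant.mp hx')

/-- The space of the values of the transformed functions: one component for each hyperoctant. -/
abbrev SignSpace (n : ℕ) : Type := EuclideanSpace ℂ (Fin n → ℤˣ)

/-- A function on `ℝⁿ`, rotated by `C`, in logarithmic coordinates on all hyperoctants,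
weighted so as to preserve the `L²` norm. -/
def logFun (C : Matrix (Fin n) (Fin n) ℝ) (f : (Fin n → ℝ) → ℂ) (t : EuclideanSpace ℝ (Fin n)) :
    SignSpace n :=
  WithLp.toLp 2 fun ε =>
    (Real.exp ((∑ k, t k) / 2) : ℂ) * f (C.mulVec (expSign ε (WithLp.ofLp t)))

theorem measurable_mulVec (C : Matrix (Fin n) (Fin n) ℝ) : Measurable C.mulVec :=
  (Continuous.matrix_mulVec continuous_const continuous_id).measurable

theorem measurable_logFun (C : Matrix (Fin n) (Fin n) ℝ) {f : (Fin n → ℝ) → ℂ}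
    (hf : Measurable f) : Measurable (logFun C f) := by
  refine (PiLp.continuous_toLp 2 _).measurable.comp (measurable_pi_lambda _ fun ε => ?_)
  have h1 : Measurable fun t : EuclideanSpace ℝ (Fin n) => WithLp.ofLp t :=
    (PiLp.continuous_ofLp 2 _).measurable
  have h2 := hf.comp ((measurable_mulVec C).comp ((measurable_expSign ε).comp h1))
  refine Measurable.mul ?_ h2
  fun_prop

theorem enorm_logFun_sq (C : Matrix (Fin n) (Fin n) ℝ) (f : (Fin n → ℝ) → ℂ)
    (t : EuclideanSpace ℝ (Fin n)) :
    ‖logFun C f t‖ₑ ^ 2 = ∑ ε, ENNReal.ofReal (Real.exp (∑ k, t k)) *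
      ‖f (C.mulVec (expSign ε (WithLp.ofLp t)))‖ₑ ^ 2 := by
  have h : ∀ z : ℂ, ‖z‖ₑ ^ 2 = ENNReal.ofReal (‖z‖ ^ 2) := fun z => by
    rw [ENNReal.ofReal_pow (norm_nonneg _), ofReal_norm]
  rw [← ofReal_norm, ← ENNReal.ofReal_pow (norm_nonneg _), EuclideanSpace.norm_sq_eq,
    ENNReal.ofReal_sum_of_nonneg fun _ _ => by positivity]
  refine Finset.sum_congr rfl fun ε _ => ?_
  rw [h, ← ENNReal.ofReal_mul (Real.exp_nonneg _)]
  congr 1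
  simp only [logFun]
  rw [norm_mul, mul_pow, Complex.norm_real, Real.norm_eq_abs, sq_abs, ← Real.exp_nat_mul]
  congr 2
  push_cast
  ring

theorem measurePreserving_mulVec {C : Matrix (Fin n) (Fin n) ℝ}
    (hC : C ∈ Matrix.orthogonalGroup (Fin n) ℝ) : MeasurePreserving C.mulVec := by
  have hdet : |C.det| = 1 := by
    have h := (Unitary.mem_iff.mp (Matrix.det_of_mem_unitary hC)).1
    rw [star_trivial] at h
    rcases mul_self_eq_one_iff.mp h with h | h <;> rw [h] <;> simp
  have h0 : C.det ≠ 0 := fun h => by simp [h] at hdet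
  refine ⟨measurable_mulVec C, ?_⟩
  have := Real.map_matrix_volume_pi_eq_smul_volume_pi h0
  rwa [abs_inv, hdet, inv_one, ENNReal.ofReal_one, one_smul] at this

theorem lintegral_logFun {C : Matrix (Fin n) (Fin n) ℝ}
    (hC : C ∈ Matrix.orthogonalGroup (Fin n) ℝ) {f : (Fin n → ℝ) → ℂ} (hf : Measurable f) :
    ∫⁻ t, ‖logFun C f t‖ₑ ^ 2 = ∫⁻ x, ‖f x‖ₑ ^ 2 := by
  have h1 : ∫⁻ x, ‖f x‖ₑ ^ 2 = ∫⁻ x, ‖f (C.mulVec x)‖ₑ ^ 2 :=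
    ((measurePreserving_mulVec hC).lintegral_comp (hf.enorm.pow_const 2)).symm
  rw [h1, lintegral_eq_sum_octant, ← lintegral_finsetSum]
  · rw [← (PiLp.volume_preserving_ofLp (Fin n)).lintegral_comp_emb
      (MeasurableEquiv.toLp 2 (Fin n → ℝ)).symm.measurableEmbedding]
    exact lintegral_congr fun t => enorm_logFun_sq C f t
  · intro ε _
    refine Measurable.mul (by fun_prop) (Measurable.pow_const (Measurable.enorm ?_) 2)
    exact hf.comp ((measurable_mulVec C).comp (measurable_expSign ε))

theorem eLpNorm_logFun {C : Matrix (Fin n) (Fin n) ℝ}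
    (hC : C ∈ Matrix.orthogonalGroup (Fin n) ℝ) {f : (Fin n → ℝ) → ℂ} (hf : Measurable f) :
    eLpNorm (logFun C f) 2 = eLpNorm f 2 := by
  simp only [eLpNorm_eq_lintegral_rpow_enorm_toReal two_ne_zero ENNReal.ofNat_ne_top,
    ENNReal.toReal_ofNat, ENNReal.rpow_ofNat, lintegral_logFun hC hf]

/-- The norm identity applied to `f - g` shows that `logFun` respects almost everywhere equality. -/
theorem logFun_congr {C : Matrix (Fin n) (Fin n) ℝ}
    (hC : C ∈ Matrix.orthogonalGroup (Fin n) ℝ) {f g : (Fin n → ℝ) → ℂ} (hf : Measurable f)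
    (hg : Measurable g) (h : f =ᵐ[volume] g) : logFun C f =ᵐ[volume] logFun C g := by
  have h1 : eLpNorm (logFun C (f - g)) 2 = 0 := by
    rw [eLpNorm_logFun hC (hf.sub hg), eLpNorm_eq_zero_iff (hf.sub hg).aestronglyMeasurable
      two_ne_zero]
    filter_upwards [h] with x hx
    simp [hx]
  rw [eLpNorm_eq_zero_iff (measurable_logFun C (hf.sub hg)).aestronglyMeasurable two_ne_zero] at h1
  filter_upwards [h1] with t ht
  rw [← sub_eq_zero, ← show logFun C (f - g) t = 0 from ht]
  ext ε
  simp [logFun, mul_sub]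

theorem memLp_logFun {C : Matrix (Fin n) (Fin n) ℝ}
    (hC : C ∈ Matrix.orthogonalGroup (Fin n) ℝ) (f : L2 n) : MemLp (logFun C f) 2 := by
  have hf := (Lp.stronglyMeasurable f).measurable
  refine ⟨(measurable_logFun C hf).aestronglyMeasurable, ?_⟩
  rw [eLpNorm_logFun hC hf]
  exact (Lp.memLp f).2

/-- The passage to logarithmic coordinates as a linear isometry. -/
def logIsometry {C : Matrix (Fin n) (Fin n) ℝ} (hC : C ∈ Matrix.orthogonalGroup (Fin n) ℝ) :
    L2 n →ₗᵢ[ℂ] Lp (SignSpace n) 2 (volume : Measure (EuclideanSpace ℝ (Fin n))) where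
  toFun f := (memLp_logFun hC f).toLp _
  map_add' f g := by
    rw [← MemLp.toLp_add]
    apply MemLp.toLp_congr
    refine (logFun_congr hC (Lp.stronglyMeasurable _).measurable
      ((Lp.stronglyMeasurable f).add (Lp.stronglyMeasurable g)).measurable
      (Lp.coeFn_add f g)).trans (.of_forall fun t => ?_)
    ext ε
    simp [logFun, mul_add]
  map_smul' c f := by
    rw [RingHom.id_apply, ← MemLp.toLp_const_smul]
    apply MemLp.toLp_congr
    refine (logFun_congr hC (Lp.stronglyMeasurable _).measurable
      ((Lp.stronglyMeasurable f).const_smul c).measurable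
      (Lp.coeFn_smul c f)).trans (.of_forall fun t => ?_)
    ext ε
    simp [logFun, mul_left_comm]
  norm_map' f := by
    simp only [LinearMap.coe_mk, AddHom.coe_mk]
    rw [Lp.norm_toLp, eLpNorm_logFun hC (Lp.stronglyMeasurable f).measurable, Lp.norm_def]

theorem logIsometry_toLp {C : Matrix (Fin n) (Fin n) ℝ}
    (hC : C ∈ Matrix.orthogonalGroup (Fin n) ℝ) {f : (Fin n → ℝ) → ℂ} (hf : Measurable f)
    (hf2 : MemLp f 2) : logIsometry hC (hf2.toLp f) =ᵐ[volume] logFun C f :=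
  (memLp_logFun hC (hf2.toLp f)).coeFn_toLp.trans
    (logFun_congr hC (Lp.stronglyMeasurable _).measurable hf hf2.coeFn_toLp)

theorem logIsometry_surjective {C : Matrix (Fin n) (Fin n) ℝ}
    (hC : C ∈ Matrix.orthogonalGroup (Fin n) ℝ) : Function.Surjective (logIsometry hC) := by
  intro g
  have hg : Measurable g := (Lp.stronglyMeasurable g).measurable
  -- The explicit preimage: on each hyperoctant take logarithms and undo the weight, then rotate
  -- back by the transpose of `C`.
  let p : (Fin n → ℤˣ) → (Fin n → ℝ) → ℂ := fun ε y =>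
    (Real.exp (-(∑ k, Real.log |y k|) / 2) : ℂ) * g (WithLp.toLp 2 fun k => Real.log |y k|) ε
  let f : (Fin n → ℝ) → ℂ := fun x => ∑ ε, (octant ε).indicator (p ε) (C.transpose.mulVec x)
  have hp : ∀ ε, Measurable (p ε) := fun ε => by
    have h1 : Measurable fun y : Fin n → ℝ =>
        (WithLp.toLp 2 fun k => Real.log |y k| : EuclideanSpace ℝ (Fin n)) :=
      (PiLp.continuous_toLp 2 _).measurable.comp
        (measurable_pi_lambda _ fun k => Real.measurable_log.comp
          (continuous_abs.measurable.comp (measurable_pi_apply k)))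
    have h2 : Measurable fun v : SignSpace n => v ε := (by fun_prop : Continuous _).measurable
    refine Measurable.mul ?_ (h2.comp (hg.comp h1))
    refine Complex.measurable_ofReal.comp (Real.measurable_exp.comp ?_)
    refine Measurable.div_const (Measurable.neg (Finset.measurable_fun_sum _ fun k _ => ?_)) 2
    exact Real.measurable_log.comp (continuous_abs.measurable.comp (measurable_pi_apply k))
  have hf : Measurable f := Finset.measurable_fun_sum _ fun ε _ =>
    ((hp ε).indicator (measurableSet_octant ε)).comp (measurable_mulVec _)
  have hfg : logFun C f = g := by
    funext t
    ext ε
    simp only [logFun, f, Matrix.mulVec_mulVec]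
    rw [show C.transpose * C = 1 from (Matrix.mem_orthogonalGroup_iff' _ _).mp hC,
      Matrix.one_mulVec, Finset.sum_eq_single ε, Set.indicator_of_mem (expSign_mem_octant.mpr rfl)]
    · simp only [p, log_abs_expSign]
      rw [← mul_assoc, ← Complex.ofReal_mul, ← Real.exp_add, neg_div, add_neg_cancel]
      simp
    · intro δ _ hδ
      rw [Set.indicator_of_notMem]
      rw [expSign_mem_octant]
      exact hδ.symm
    · simp
  have hf2 : MemLp f 2 := by
    refine ⟨hf.aestronglyMeasurable, ?_⟩
    rw [← eLpNorm_logFun hC hf, hfg]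
    exact (Lp.memLp g).2
  refine ⟨hf2.toLp f, Lp.ext ?_⟩
  rw [← hfg]
  exact logIsometry_toLp hC hf hf2

/-- The passage to logarithmic coordinates as a unitary operator. -/
def logUnitary {C : Matrix (Fin n) (Fin n) ℝ} (hC : C ∈ Matrix.orthogonalGroup (Fin n) ℝ) :
    L2 n ≃ₗᵢ[ℂ] Lp (SignSpace n) 2 (volume : Measure (EuclideanSpace ℝ (Fin n))) :=
  LinearIsometryEquiv.ofSurjective (logIsometry hC) (logIsometry_surjective hC)

theorem logUnitary_toLp {C : Matrix (Fin n) (Fin n) ℝ}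
    (hC : C ∈ Matrix.orthogonalGroup (Fin n) ℝ) {f : (Fin n → ℝ) → ℂ} (hf : Measurable f)
    (hf2 : MemLp f 2) : logUnitary hC (hf2.toLp f) =ᵐ[volume] logFun C f :=
  logIsometry_toLp hC hf hf2

end LogCoordinates

/-! ### Translations under the Fourier transform on `L²` -/

section Fourier

open scoped BoundedContinuousFunction FourierTransform SchwartzMap

variable {E F : Type*} [NormedAddCommGroup E] [InnerProductSpace ℝ E]

/-- The character `ξ ↦ exp(2πi⟨b, ξ⟩)`. -/
def charBCF (b : E) : E →ᵇ ℂ :=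
  BoundedContinuousFunction.ofNormedAddCommGroup (fun ξ => (Real.fourierChar (inner ℝ b ξ) : ℂ))
    (by fun_prop) 1 fun _ => (Circle.norm_coe _).le

@[simp]
theorem charBCF_apply (b ξ : E) : charBCF b ξ = (Real.fourierChar (inner ℝ b ξ) : ℂ) := rfl

variable [FiniteDimensional ℝ E] [MeasurableSpace E] [BorelSpace E]
  [NormedAddCommGroup F] [InnerProductSpace ℂ F] [CompleteSpace F]

theorem fourier_comp_add_const (J : F →L[ℂ] F) (h : 𝓢(E, F)) (b ξ : E) :
    𝓕 (fun x => J (h (x + b))) ξ = charBCF b ξ • J (𝓕 (h : E → F) ξ) := by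
  have h1 : 𝓕 (fun x => J (h (x + b))) ξ =
      (Real.fourierChar (inner ℝ b ξ)) • 𝓕 (fun x => J (h x)) ξ :=
    congrFun (VectorFourier.fourierIntegral_comp_add_right Real.fourierChar volume
      (innerₗ E) (fun x => J (h x)) b) ξ
  rw [h1, charBCF_apply, Circle.smul_def]
  congr 1
  rw [Real.fourier_eq, Real.fourier_eq, ← J.integral_comp_comm]
  · simp [Circle.smul_def]
  · exact (Real.fourierIntegral_convergent_iff ξ).mpr h.integrable

theorem measurePreserving_add_const (b : E) : MeasurePreserving (fun x : E => x + b) :=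
  measurePreserving_add_right volume b

/-- Both sides are continuous in `g`, so it suffices to check Schwartz functions, where the Fourier
integral is available. -/
theorem fourierL2_translate (J : F →L[ℂ] F) (b : E) (g : Lp F 2 (volume : Measure E)) :
    Lp.fourierTransformₗᵢ E F
        (J.compLpL 2 volume (Lp.compMeasurePreserving _ (measurePreserving_add_const b) g)) =
      mulOp volume F (charBCF b) (J.compLpL 2 volume (Lp.fourierTransformₗᵢ E F g)) := by
  refine (SchwartzMap.denseRange_toLpCLM (F := F) (μ := (volume : Measure E)) (p := 2)
    ENNReal.ofNat_ne_top).induction_on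
    (p := fun g : Lp F 2 (volume : Measure E) => Lp.fourierTransformₗᵢ E F
        (J.compLpL 2 volume (Lp.compMeasurePreserving _ (measurePreserving_add_const b) g)) =
      mulOp volume F (charBCF b) (J.compLpL 2 volume (Lp.fourierTransformₗᵢ E F g))) g ?_ ?_
  · refine isClosed_eq ?_ ?_
    · exact (Lp.fourierTransformₗᵢ E F).continuous.comp ((J.compLpL 2 volume).continuous.comp
        (Lp.isometry_compMeasurePreserving (measurePreserving_add_const b)).continuous)
    · exact (mulOp volume F (charBCF b)).continuous.comp ((J.compLpL 2 volume).continuous.comp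
        (Lp.fourierTransformₗᵢ E F).continuous)
  · intro h
    set h' : 𝓢(E, F) := (SchwartzMap.compSubConstCLM ℂ (-b) h).postcompCLM J with hh'
    have hval : ∀ x, h' x = J (h (x + b)) := fun x => by
      simp [hh', SchwartzMap.postcompCLM_apply]
    have h1 : J.compLpL 2 volume (Lp.compMeasurePreserving _ (measurePreserving_add_const b)
        (SchwartzMap.toLpCLM ℝ F 2 volume h)) = h'.toLp 2 := by
      apply Lp.ext
      filter_upwards [J.coeFn_compLpL (p := 2) (Lp.compMeasurePreserving _
          (measurePreserving_add_const b) (SchwartzMap.toLpCLM ℝ F 2 volume h)),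
        Lp.coeFn_compMeasurePreserving (SchwartzMap.toLpCLM ℝ F 2 volume h)
          (measurePreserving_add_const b), h'.coeFn_toLp 2,
        (measurePreserving_add_const b).quasiMeasurePreserving.ae
          (p := fun x => h.toLp 2 volume x = h x) (h.coeFn_toLp 2 volume)] with x h1 h2 h3 h4
      rw [h1, h2, h3, hval, Function.comp_apply]
      exact congrArg J h4
    have h2 : Lp.fourierTransformₗᵢ E F (h'.toLp 2) = (𝓕 h').toLp 2 := h'.toLp_fourier_eq
    have h3 : Lp.fourierTransformₗᵢ E F (SchwartzMap.toLpCLM ℝ F 2 volume h) = (𝓕 h).toLp 2 :=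
      h.toLp_fourier_eq
    rw [h1, h2, h3]
    apply Lp.ext
    filter_upwards [(𝓕 h').coeFn_toLp 2, (𝓕 h).coeFn_toLp 2,
      coeFn_mulOp (charBCF b) (J.compLpL 2 volume ((𝓕 h).toLp 2)),
      J.coeFn_compLpL (p := 2) ((𝓕 h).toLp 2)] with ξ h1 h2 h3 h4
    rw [h1, h3, h4, h2, SchwartzMap.fourier_coe, SchwartzMap.fourier_coe,
      ← fourier_comp_add_const]
    exact congrFun (congrArg _ (funext hval)) ξ

end Fourier

/-! ### Dilations under the Mellin transform -/

section Dilation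

variable {n : ℕ}

/-- The reflection of the hyperoctants at the origin. -/
def signFlip (n : ℕ) : SignSpace n →L[ℂ] SignSpace n :=
  (LinearIsometryEquiv.piLpCongrLeft 2 ℂ ℂ (Equiv.neg (Fin n → ℤˣ))).toContinuousLinearEquiv

@[simp]
theorem signFlip_apply (v : SignSpace n) (ε : Fin n → ℤˣ) : signFlip n v ε = v (-ε) := rfl

theorem norm_signFlip (v : SignSpace n) : ‖signFlip n v‖ = ‖v‖ :=
  (LinearIsometryEquiv.piLpCongrLeft 2 ℂ ℂ (Equiv.neg (Fin n → ℤˣ))).norm_map v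

theorem signFlip_signFlip (v : SignSpace n) : signFlip n (signFlip n v) = v := by
  ext ε
  simp

/-- The vector of the logarithms of `|aₖ|`. -/
def logAbs (a : Fin n → ℝ) : EuclideanSpace ℝ (Fin n) := WithLp.toLp 2 fun k => Real.log |a k|

/-- The composition with `A`, weighted by the square root of the determinant. -/
def dilate (A : Matrix (Fin n) (Fin n) ℝ) (a : Fin n → ℝ) (f : (Fin n → ℝ) → ℂ)
    (x : Fin n → ℝ) : ℂ :=
  (Real.exp ((∑ k, Real.log |a k|) / 2) : ℂ) * f (A.mulVec x)

theorem measurable_dilate (A : Matrix (Fin n) (Fin n) ℝ) (a : Fin n → ℝ) {f : (Fin n → ℝ) → ℂ}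
    (hf : Measurable f) : Measurable (dilate A a f) :=
  (hf.comp (measurable_mulVec A)).const_mul _

variable {A C : Matrix (Fin n) (Fin n) ℝ} {a : Fin n → ℝ}

/-- As `aₖ = -exp (log |aₖ|)`, multiplying `εₖ exp tₖ` by `aₖ` shifts `tₖ` by `log |aₖ|` and flips
`εₖ`. The weight of `dilate` supplies the matching shift in the weight of `logFun`. -/
theorem logFun_dilate (hAC : A * C = C * Matrix.diagonal a) (ha : ∀ k, a k < 0)
    (f : (Fin n → ℝ) → ℂ) (t : EuclideanSpace ℝ (Fin n)) :
    logFun C (dilate A a f) t = signFlip n (logFun C f (t + logAbs a)) := by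
  ext ε
  have h : (Matrix.diagonal a).mulVec (expSign ε (WithLp.ofLp t)) =
      expSign (-ε) (WithLp.ofLp (t + logAbs a)) := by
    funext k
    rw [Matrix.mulVec_diagonal]
    simp only [expSign, signMul, logAbs, WithLp.ofLp_add, Pi.add_apply, Pi.neg_apply, Real.exp_add,
      abs_of_neg (ha k), Real.exp_log (neg_pos.mpr (ha k))]
    push_cast
    ring
  simp only [logFun, dilate, signFlip_apply, Matrix.mulVec_mulVec, hAC]
  rw [← Matrix.mulVec_mulVec, h, ← mul_assoc, ← Complex.ofReal_mul, ← Real.exp_add]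
  congr 3
  simp [logAbs, Finset.sum_add_distrib, add_div]

theorem eLpNorm_dilate (hC : C ∈ Matrix.orthogonalGroup (Fin n) ℝ)
    (hAC : A * C = C * Matrix.diagonal a) (ha : ∀ k, a k < 0) {f : (Fin n → ℝ) → ℂ}
    (hf : Measurable f) : eLpNorm (dilate A a f) 2 = eLpNorm f 2 := by
  rw [← eLpNorm_logFun hC (measurable_dilate A a hf), ← eLpNorm_logFun hC hf,
    ← eLpNorm_comp_measurePreserving (measurable_logFun C hf).aestronglyMeasurable
      (measurePreserving_add_const (logAbs a))]
  refine eLpNorm_congr_norm_ae (.of_forall fun t => ?_)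
  rw [logFun_dilate hAC ha, norm_signFlip, Function.comp_apply]

theorem memLp_dilate (hC : C ∈ Matrix.orthogonalGroup (Fin n) ℝ)
    (hAC : A * C = C * Matrix.diagonal a) (ha : ∀ k, a k < 0) (f : L2 n) :
    MemLp (dilate A a f) 2 := by
  have hf := (Lp.stronglyMeasurable f).measurable
  refine ⟨(measurable_dilate A a hf).aestronglyMeasurable, ?_⟩
  rw [eLpNorm_dilate hC hAC ha hf]
  exact (Lp.memLp f).2

/-- The Mellin transform on all hyperoctants, after a rotation. -/
def mellin (hC : C ∈ Matrix.orthogonalGroup (Fin n) ℝ) :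
    L2 n ≃ₗᵢ[ℂ] Lp (SignSpace n) 2 (volume : Measure (EuclideanSpace ℝ (Fin n))) :=
  (logUnitary hC).trans (Lp.fourierTransformₗᵢ (EuclideanSpace ℝ (Fin n)) (SignSpace n))

theorem mellin_dilate (hC : C ∈ Matrix.orthogonalGroup (Fin n) ℝ)
    (hAC : A * C = C * Matrix.diagonal a) (ha : ∀ k, a k < 0) (f : L2 n) :
    mellin hC ((memLp_dilate hC hAC ha f).toLp _) =
      mulOp volume _ (charBCF (logAbs a)) ((signFlip n).compLpL 2 volume (mellin hC f)) := by
  simp only [mellin, LinearIsometryEquiv.trans_apply]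
  rw [← fourierL2_translate]
  congr 1
  apply Lp.ext
  have hf := (Lp.stronglyMeasurable f).measurable
  filter_upwards [logUnitary_toLp hC (measurable_dilate A a hf) (memLp_dilate hC hAC ha f),
    (signFlip n).coeFn_compLpL (p := 2) (Lp.compMeasurePreserving _
      (measurePreserving_add_const (logAbs a)) (logUnitary hC f)),
    Lp.coeFn_compMeasurePreserving (logUnitary hC f) (measurePreserving_add_const (logAbs a)),
    (measurePreserving_add_const (logAbs a)).quasiMeasurePreserving.ae
      (memLp_logFun hC f).coeFn_toLp] with t h1 h2 h3 h4
  rw [h1, h2, h3, logFun_dilate hAC ha]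
  exact congrArg (signFlip n) h4.symm

end Dilation

/-! ### The Hausdorff operator, its spectrum and its norm -/

section Operator

open scoped BoundedContinuousFunction ENNReal

variable {Ω : Type*} {n : ℕ} {K : Ω → ℂ}
  {A : Ω → Matrix (Fin n) (Fin n) ℝ} {C : Matrix (Fin n) (Fin n) ℝ} {a : Ω → Fin n → ℝ}

/-- The kernel `|det A(u)|^{-1/2} K(u)` in terms of the eigenvalues of `A(u)`. -/
def weightedKernel (K : Ω → ℂ) (a : Ω → Fin n → ℝ) (u : Ω) : ℂ :=
  (Real.exp (-(∑ k, Real.log |a u k|) / 2) : ℂ) * K u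

theorem weightedKernel_mul_dilate (u : Ω) (f : (Fin n → ℝ) → ℂ) (x : Fin n → ℝ) :
    weightedKernel K a u * dilate (A u) (a u) f x = K u * f ((A u).mulVec x) := by
  have : (Real.exp (-(∑ k, Real.log |a u k|) / 2) : ℂ) *
      (Real.exp ((∑ k, Real.log |a u k|) / 2) : ℂ) = 1 := by
    rw [← Complex.ofReal_mul, ← Real.exp_add, neg_div, neg_add_cancel]
    simp
  rw [weightedKernel, dilate]
  linear_combination (K u * f ((A u).mulVec x)) * this

theorem abs_det_rpow (h : IsDiagonalization A C a) (ha : ∀ u k, a u k < 0) (u : Ω) :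
    |(A u).det| ^ (-(1 / 2) : ℝ) = Real.exp (-(∑ k, Real.log |a u k|) / 2) := by
  rw [h.det_eq, Finset.abs_prod, Real.rpow_def_of_pos
    (Finset.prod_pos fun k _ => abs_pos.mpr (ha u k).ne),
    Real.log_prod fun k _ => (abs_pos.mpr (ha u k).ne).ne']
  congr 1
  ring

/-- Matching `2πi ξₖ` with `-i sₖ` forces `s = -2πξ`. -/
theorem weightedKernel_mul_charBCF (u : Ω) (ξ : EuclideanSpace ℝ (Fin n)) :
    weightedKernel K a u * charBCF (logAbs (a u)) ξ =
      K u * absPow (a u) fun k => -(2 * Real.pi * ξ k) := by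
  rw [weightedKernel, mul_right_comm, mul_comm _ (K u), charBCF_apply, Real.fourierChar_apply,
    absPow, ← Complex.exp_sum, Complex.ofReal_exp, ← Complex.exp_add]
  congr 2
  simp only [PiLp.inner_apply, logAbs, RCLike.inner_apply, conj_trivial]
  push_cast
  rw [Finset.mul_sum, Finset.sum_mul, ← Finset.sum_neg_distrib, Finset.sum_div,
    ← Finset.sum_add_distrib]
  refine Finset.sum_congr rfl fun k _ => ?_
  ring

theorem norm_weightedKernel_mul_charBCF (u : Ω) (ξ : EuclideanSpace ℝ (Fin n)) :
    ‖weightedKernel K a u * charBCF (logAbs (a u)) ξ‖ = ‖weightedKernel K a u‖ := by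
  rw [norm_mul, charBCF_apply, Circle.norm_coe, mul_one]

variable [MeasurableSpace Ω] {μ : Measure Ω}

theorem scalarSymbol_eq (ξ : EuclideanSpace ℝ (Fin n)) :
    scalarSymbol μ K a (fun k => -(2 * Real.pi * ξ k)) =
      ∫ u, weightedKernel K a u * charBCF (logAbs (a u)) ξ ∂μ :=
  integral_congr_ae (.of_forall fun u => (weightedKernel_mul_charBCF u ξ).symm)

theorem aemeasurable_logAbs (ha : ∀ k, AEMeasurable (fun u => a u k) μ) :
    AEMeasurable (fun u => logAbs (a u)) μ :=
  (PiLp.continuous_toLp 2 _).measurable.comp_aemeasurable (aemeasurable_pi_lambda _ fun k =>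
    Real.measurable_log.comp_aemeasurable (continuous_abs.measurable.comp_aemeasurable (ha k)))

/-- The symbol in Fourier coordinates. -/
def symbolBCF (hk : Integrable (weightedKernel K a) μ)
    (ha : ∀ k, AEMeasurable (fun u => a u k) μ) : EuclideanSpace ℝ (Fin n) →ᵇ ℂ :=
  BoundedContinuousFunction.ofNormedAddCommGroup
    (fun ξ => ∫ u, weightedKernel K a u * charBCF (logAbs (a u)) ξ ∂μ)
    (continuous_of_dominated (bound := fun u => ‖weightedKernel K a u‖)
      (fun ξ => hk.aestronglyMeasurable.mul (by
        have h : Continuous fun b : EuclideanSpace ℝ (Fin n) =>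
            (Real.fourierChar (inner ℝ b ξ) : ℂ) := by fun_prop
        exact h.comp_aestronglyMeasurable (aemeasurable_logAbs ha).aestronglyMeasurable))
      (fun ξ => .of_forall fun u => (norm_weightedKernel_mul_charBCF u ξ).le) hk.norm
      (.of_forall fun u => continuous_const.mul (charBCF (logAbs (a u))).continuous))
    (∫ u, ‖weightedKernel K a u‖ ∂μ)
    fun ξ => (norm_integral_le_integral_norm _).trans_eq
      (integral_congr_ae (.of_forall fun u => norm_weightedKernel_mul_charBCF u ξ))

theorem symbolBCF_apply (hk : Integrable (weightedKernel K a) μ)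
    (ha : ∀ k, AEMeasurable (fun u => a u k) μ) (ξ : EuclideanSpace ℝ (Fin n)) :
    symbolBCF hk ha ξ = ∫ u, weightedKernel K a u * charBCF (logAbs (a u)) ξ ∂μ := rfl

theorem range_comp_symbolBCF {β : Type*} (p : ℂ → β) (hk : Integrable (weightedKernel K a) μ)
    (ha : ∀ k, AEMeasurable (fun u => a u k) μ) :
    Set.range (fun ξ => p (symbolBCF hk ha ξ)) = Set.range fun s => p (scalarSymbol μ K a s) := by
  apply Set.Subset.antisymm
  · rintro _ ⟨ξ, rfl⟩
    exact ⟨_, congrArg p (scalarSymbol_eq ξ)⟩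
  · rintro _ ⟨s, rfl⟩
    refine ⟨WithLp.toLp 2 fun k => -(s k / (2 * Real.pi)), congrArg p ?_⟩
    rw [symbolBCF_apply, ← scalarSymbol_eq]
    congr 1
    funext k
    have := Real.pi_pos.ne'
    simp
    field_simp

/-- The operator that the Mellin transform turns into multiplication by the symbol. -/
def symbolOp (hC : C ∈ Matrix.orthogonalGroup (Fin n) ℝ)
    (hk : Integrable (weightedKernel K a) μ) (ha : ∀ k, AEMeasurable (fun u => a u k) μ) :
    L2 n →L[ℂ] L2 n :=
  (mellin hC).symm.conjStarAlgEquiv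
    (mulOp volume _ (symbolBCF hk ha) * (signFlip n).compLpL 2 volume)

theorem integrable_kernel_mul_charBCF [SFinite μ] (hk : Integrable (weightedKernel K a) μ)
    (ha : ∀ k, AEMeasurable (fun u => a u k) μ) {q : EuclideanSpace ℝ (Fin n) → ℂ}
    (hq : Integrable q) :
    Integrable (Function.uncurry fun (ξ : EuclideanSpace ℝ (Fin n)) (u : Ω) =>
      weightedKernel K a u * charBCF (logAbs (a u)) ξ * q ξ) (volume.prod μ) := by
  have h1 := hq.mul_prod hk
  refine h1.mono ?_ (.of_forall fun p => ?_)
  · have h2 : Continuous fun p : EuclideanSpace ℝ (Fin n) × EuclideanSpace ℝ (Fin n) =>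
      (Real.fourierChar (inner ℝ p.2 p.1) : ℂ) := by fun_prop
    have h3 : AEMeasurable (fun p : EuclideanSpace ℝ (Fin n) × Ω => (p.1, logAbs (a p.2)))
        (volume.prod μ) := measurable_fst.aemeasurable.prodMk (aemeasurable_logAbs ha).comp_snd
    refine (h1.aestronglyMeasurable.mul
      (h2.measurable.comp_aemeasurable h3).aestronglyMeasurable).congr (.of_forall fun p => ?_)
    simp only [Function.uncurry, charBCF_apply, Pi.mul_apply, Function.comp_apply]
    ring
  · simp only [Function.uncurry]
    rw [norm_mul, norm_weightedKernel_mul_charBCF, norm_mul, mul_comm]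

/-- The spectral representation in weak form. -/
theorem inner_symbolOp [SFinite μ] (h : IsDiagonalization A C a)
    (hk : Integrable (weightedKernel K a) μ)
    (ha : ∀ k, AEMeasurable (fun u => a u k) μ) (hneg : ∀ u k, a u k < 0) (f g : L2 n) :
    inner ℂ g (symbolOp h.1 hk ha f) = ∫ u, weightedKernel K a u *
      inner ℂ g ((memLp_dilate h.1 (h.mul_eq u) (hneg u) f).toLp _) ∂μ := by
  set G := mellin h.1
  set P := (signFlip n).compLpL 2 (volume : Measure (EuclideanSpace ℝ (Fin n))) (G f)
  set q : EuclideanSpace ℝ (Fin n) → ℂ := fun ξ => inner ℂ (G g ξ) (P ξ) with hq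
  have hqi : Integrable q := L2.integrable_inner (G g) P
  have hm : ∀ m : EuclideanSpace ℝ (Fin n) →ᵇ ℂ,
      inner ℂ (G g) (mulOp volume _ m P) = ∫ ξ, m ξ * q ξ := fun m => by
    rw [L2.inner_def]
    refine integral_congr_ae ?_
    filter_upwards [coeFn_mulOp m P] with ξ hξ
    rw [hξ, inner_smul_right]
  have h1 : inner ℂ g (symbolOp h.1 hk ha f) = ∫ ξ, symbolBCF hk ha ξ * q ξ := by
    rw [← hm, ← G.inner_map_map]
    congr 1
    exact G.apply_symm_apply _
  have h2 : ∀ u, inner ℂ g ((memLp_dilate h.1 (h.mul_eq u) (hneg u) f).toLp _) =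
      ∫ ξ, charBCF (logAbs (a u)) ξ * q ξ := fun u => by
    rw [← hm, ← G.inner_map_map, mellin_dilate h.1 (h.mul_eq u) (hneg u)]
  have hint : Integrable (Function.uncurry fun (ξ : EuclideanSpace ℝ (Fin n)) (u : Ω) =>
      weightedKernel K a u * charBCF (logAbs (a u)) ξ * q ξ) (volume.prod μ) :=
    integrable_kernel_mul_charBCF hk ha hqi
  rw [h1]
  simp_rw [h2, symbolBCF_apply, ← integral_mul_const, ← integral_const_mul]
  rw [integral_integral_swap hint]
  simp_rw [mul_assoc]

theorem aemeasurable_eigenvalue (h : IsDiagonalization A C a)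
    (hA : ∀ i j, AEMeasurable (fun u => A u i j) μ) (k : Fin n) :
    AEMeasurable (fun u => a u k) μ := by
  simp_rw [h.entry_eq]
  refine Finset.aemeasurable_fun_sum _ fun i _ => Finset.aemeasurable_fun_sum _ fun j _ => ?_
  exact ((hA i j).const_mul _).mul_const _

/-- `f` need not be integrable, but on a set `s` of finite measure Hölder bounds the `L¹` norm of
every normalized dilate by `‖f‖₂ |s|^{1/2}`, uniformly in `u`; the weighted kernel is integrable in
`u`. -/
theorem integrable_prod_kernel [SFinite μ] (h : IsDiagonalization A C a)
    (hA : ∀ i j, AEMeasurable (fun u => A u i j) μ)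
    (hk : Integrable (weightedKernel K a) μ) (hneg : ∀ u k, a u k < 0) (f : L2 n)
    {s : Set (Fin n → ℝ)} (hs : volume s ≠ ∞) :
    Integrable (fun p : Ω × (Fin n → ℝ) => K p.1 * f ((A p.1).mulVec p.2))
      (μ.prod (volume.restrict s)) := by
  have hf := (Lp.stronglyMeasurable f).measurable
  have hmeas : AEMeasurable (fun p : Ω × (Fin n → ℝ) =>
      weightedKernel K a p.1 * dilate (A p.1) (a p.1) f p.2) (μ.prod (volume.restrict s)) := by
    refine hk.aestronglyMeasurable.aemeasurable.comp_fst.mul (AEMeasurable.mul ?_ ?_)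
    · refine Complex.measurable_ofReal.comp_aemeasurable
        (Real.measurable_exp.comp_aemeasurable (AEMeasurable.div_const ?_ 2))
      refine Finset.aemeasurable_fun_sum _ fun k _ => Real.measurable_log.comp_aemeasurable
        (continuous_abs.measurable.comp_aemeasurable ?_)
      exact (aemeasurable_eigenvalue h hA k).comp_fst
    · refine hf.comp_aemeasurable (aemeasurable_pi_lambda _ fun i => ?_)
      simp only [Matrix.mulVec, dotProduct]
      refine Finset.aemeasurable_fun_sum _ fun j _ => AEMeasurable.mul (hA i j).comp_fst ?_
      exact ((measurable_pi_apply j).comp measurable_snd).aemeasurable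
  have key : Integrable (fun p : Ω × (Fin n → ℝ) =>
      weightedKernel K a p.1 * dilate (A p.1) (a p.1) f p.2) (μ.prod (volume.restrict s)) := by
    refine ⟨hmeas.aestronglyMeasurable, ?_⟩
    rw [HasFiniteIntegral, lintegral_prod _ hmeas.enorm]
    set c : ℝ≥0∞ := eLpNorm f 2 volume * volume s ^ (1 / 2 : ℝ)
    have hc : c ≠ ∞ := ENNReal.mul_ne_top (Lp.memLp f).2.ne
      (ENNReal.rpow_ne_top_of_nonneg (by norm_num) hs)
    have hle : ∀ u, ∫⁻ x in s, ‖weightedKernel K a u * dilate (A u) (a u) f x‖ₑ ≤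
        ‖weightedKernel K a u‖ₑ * c := fun u => by
      have hd := measurable_dilate (A u) (a u) hf
      simp_rw [enorm_mul]
      rw [lintegral_const_mul _ hd.enorm, ← eLpNorm_one_eq_lintegral_enorm]
      gcongr
      have h1 := eLpNorm_le_eLpNorm_mul_rpow_measure_univ (μ := volume.restrict s)
        (p := 1) (q := 2) (by norm_num) hd.aestronglyMeasurable
      rw [Measure.restrict_apply_univ] at h1
      norm_num at h1
      refine h1.trans ?_
      simp only [c, ← eLpNorm_dilate h.1 (h.mul_eq u) (hneg u) hf]
      gcongr
      exact Measure.restrict_le_self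
    refine (lintegral_mono hle).trans_lt ?_
    rw [lintegral_mul_const' _ _ hc]
    exact ENNReal.mul_lt_top hk.2 hc.lt_top
  exact key.congr (.of_forall fun p => weightedKernel_mul_dilate p.1 f p.2)

/-- Two functions integrable on sets of finite measure agree almost everywhere once their integrals
over such sets do. Those integrals are inner products with indicators, so `inner_symbolOp` and
Fubini apply. -/
theorem isHausdorffOperator_symbolOp [SFinite μ] (h : IsDiagonalization A C a)
    (hA : ∀ i j, AEMeasurable (fun u => A u i j) μ)
    (hk : Integrable (weightedKernel K a) μ) (hneg : ∀ u k, a u k < 0) :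
    IsHausdorffOperator μ K A (symbolOp h.1 hk (aemeasurable_eigenvalue h hA)) := by
  intro f
  have hprod : ∀ s : Set (Fin n → ℝ), volume s ≠ ∞ →
      Integrable (fun p : Ω × (Fin n → ℝ) => K p.1 * f ((A p.1).mulVec p.2))
        (μ.prod (volume.restrict s)) := fun s => integrable_prod_kernel h hA hk hneg f
  refine ⟨?_, ?_⟩
  · have h1 : ∀ i, ∀ᵐ x ∂(volume.restrict (spanningSets (volume : Measure (Fin n → ℝ)) i)),
        Integrable (fun u => K u * f ((A u).mulVec x)) μ := fun i =>
      (hprod _ (measure_spanningSets_lt_top volume i).ne).prod_left_ae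
    rw [← ae_restrict_iUnion_iff, iUnion_spanningSets, Measure.restrict_univ] at h1
    exact h1
  · set T := symbolOp h.1 hk (aemeasurable_eigenvalue h hA)
    have hTi : ∀ s : Set (Fin n → ℝ), volume s < ∞ → IntegrableOn (T f) s := fun s hs => by
      have : IsFiniteMeasure (volume.restrict s) := ⟨by simpa using hs⟩
      exact ((Lp.memLp (T f)).restrict s).integrable (by norm_num)
    have hSi : ∀ s : Set (Fin n → ℝ), volume s < ∞ →
        IntegrableOn (fun x => ∫ u, K u * f ((A u).mulVec x) ∂μ) s := fun s hs =>
      (hprod s hs.ne).integral_prod_right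
    have hz := ae_eq_zero_of_forall_setIntegral_eq_of_sigmaFinite
      (μ := (volume : Measure (Fin n → ℝ)))
      (f := fun x => T f x - ∫ u, K u * f ((A u).mulVec x) ∂μ)
      (fun s _ hs => (hTi s hs).sub (hSi s hs)) fun s hs hfin => by
        rw [integral_sub (hTi s hfin) (hSi s hfin), sub_eq_zero,
          ← L2.inner_indicatorConstLp_one (𝕜 := ℂ) hs hfin.ne (T f), inner_symbolOp h hk _ hneg,
          ← integral_integral_swap (f := fun u x => K u * f ((A u).mulVec x))
            (hprod s hfin.ne)]
        refine integral_congr_ae (.of_forall fun u => ?_)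
        simp only
        rw [L2.inner_indicatorConstLp_one, ← integral_const_mul]
        refine integral_congr_ae (ae_restrict_of_ae ?_)
        filter_upwards [(memLp_dilate h.1 (h.mul_eq u) (hneg u) f).coeFn_toLp] with x hx
        rw [hx, weightedKernel_mul_dilate]
    filter_upwards [hz] with x hx
    exact sub_eq_zero.mp hx

theorem IsHausdorffOperator.unique {S T : L2 n →L[ℂ] L2 n} (hS : IsHausdorffOperator μ K A S)
    (hT : IsHausdorffOperator μ K A T) : S = T := by
  ext1 f
  apply Lp.ext
  filter_upwards [(hS f).2, (hT f).2] with x h1 h2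
  rw [h1, h2]

theorem norm_symbolOp (hC : C ∈ Matrix.orthogonalGroup (Fin n) ℝ)
    (hk : Integrable (weightedKernel K a) μ) (ha : ∀ k, AEMeasurable (fun u => a u k) μ) :
    ‖symbolOp hC hk ha‖ =
      ‖mulOp volume _ (symbolBCF hk ha) * (signFlip n).compLpL 2 volume‖ := by
  exact NonUnitalStarAlgHom.norm_map (mellin hC).symm.conjStarAlgEquiv
    (mellin hC).symm.conjStarAlgEquiv.injective _

theorem spectrum_symbolOp (hn : n ≠ 0) (hC : C ∈ Matrix.orthogonalGroup (Fin n) ℝ)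
    (hk : Integrable (weightedKernel K a) μ) (ha : ∀ k, AEMeasurable (fun u => a u k) μ) :
    spectrum ℂ (symbolOp hC hk ha) = closure (Set.range (fun s => -scalarSymbol μ K a s) ∪
      Set.range (scalarSymbol μ K a)) := by
  let k : Fin n := ⟨0, Nat.pos_of_ne_zero hn⟩
  let v : SignSpace n := WithLp.toLp 2 fun _ => 1
  -- The sign of one coordinate is odd under the antipodal map, which gives the eigenvalue `-1`; a
  -- coordinate exists since `n ≠ 0`.
  let w : SignSpace n := WithLp.toLp 2 fun ε => if ε k = 1 then 1 else -1
  have hv : v ≠ 0 := fun h => by simpa [v] using congrArg (fun x : SignSpace n => x 1) h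
  have hw : w ≠ 0 := fun h => by simpa [w] using congrArg (fun x : SignSpace n => x 1) h
  have hJv : signFlip n v = v := by
    ext ε
    simp [v]
  have hJw : signFlip n w = -w := by
    ext ε
    have : ¬ (-1 : ℤˣ) = 1 := by decide
    rcases Int.units_eq_one_or (ε k) with h | h <;> simp [w, h, this]
  rw [symbolOp, AlgEquiv.spectrum_eq (mellin hC).symm.conjStarAlgEquiv,
    spectrum_mulOp_comp _ signFlip_signFlip hv hJv hw hJw]
  congr 2
  · exact range_comp_symbolBCF (fun z => -z) hk ha
  · exact range_comp_symbolBCF (fun z => z) hk ha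

theorem isLUB_norm_symbolOp (hn : n ≠ 0) (hC : C ∈ Matrix.orthogonalGroup (Fin n) ℝ)
    (hk : Integrable (weightedKernel K a) μ) (ha : ∀ k, AEMeasurable (fun u => a u k) μ) :
    IsLUB (Set.range fun s => ‖scalarSymbol μ K a s‖) ‖symbolOp hC hk ha‖ := by
  refine ⟨?_, fun c hc => ?_⟩
  · rintro _ ⟨s, rfl⟩
    have h : scalarSymbol μ K a s ∈ spectrum ℂ (symbolOp hC hk ha) := by
      rw [spectrum_symbolOp hn hC hk ha]
      exact subset_closure (.inr ⟨s, rfl⟩)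
    refine (spectrum.norm_le_norm_mul_of_mem h).trans ?_
    exact mul_le_of_le_one_right (norm_nonneg _) ContinuousLinearMap.norm_id_le
  · rw [norm_symbolOp]
    refine norm_mulOp_comp_le _ (fun v => (norm_signFlip v).le)
      ((norm_nonneg _).trans (hc ⟨0, rfl⟩)) fun ξ => hc ?_
    rw [← range_comp_symbolBCF norm hk ha]
    exact ⟨ξ, rfl⟩

end Operator

end HausdorffOp

end

theorem corollary8 {Ω : Type*} [TopologicalSpace Ω] [SigmaCompactSpace Ω] [MeasurableSpace Ω]
    [BorelSpace Ω] (μ : Measure Ω) [μ.Regular] {n : ℕ} (hn : n ≠ 0)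
    (K : Ω → ℂ) (hK : LocallyIntegrable K μ)
    (A : Ω → Matrix (Fin n) (Fin n) ℝ) (hA : ∀ i j, AEMeasurable (fun u => A u i j) μ)
    (hcomm : ∀ u v, Commute (A u) (A v)) (hneg : ∀ u, (-(A u)).PosDef)
    (hint : Integrable (fun u => ((|(A u).det| ^ (-(1 / 2) : ℝ) : ℝ) : ℂ) * K u) μ) :
    (∃ C a, HausdorffOp.IsDiagonalization A C a) ∧
    (∃! T : HausdorffOp.L2 n →L[ℂ] HausdorffOp.L2 n, HausdorffOp.IsHausdorffOperator μ K A T) ∧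
    ∃ U : Fin (2 ^ n) ≃ HausdorffOp.hyperoctants n,
      ∀ C a, HausdorffOp.IsDiagonalization A C a →
        (∀ s, HausdorffOp.matrixSymbol μ K a U s =
          Matrix.reindex (HausdorffOp.halves hn) (HausdorffOp.halves hn)
            (Matrix.fromBlocks 0 (HausdorffOp.scalarSymbol μ K a s • 1)
              (HausdorffOp.scalarSymbol μ K a s • 1) 0)) ∧
        ∀ T : HausdorffOp.L2 n →L[ℂ] HausdorffOp.L2 n, HausdorffOp.IsHausdorffOperator μ K A T →
          spectrum ℂ T = closure (Set.range (fun s => -HausdorffOp.scalarSymbol μ K a s) ∪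
            Set.range (HausdorffOp.scalarSymbol μ K a)) ∧
          IsLUB (Set.range fun s => ‖HausdorffOp.scalarSymbol μ K a s‖) ‖T‖ := by
  have hdiag := HausdorffOp.exists_isDiagonalization A hcomm fun u => by
    simpa using (hneg u).isHermitian.neg
  have hnega : ∀ {C a}, HausdorffOp.IsDiagonalization A C a → ∀ u k, a u k < 0 :=
    fun h u => h.neg_of_posDef (hneg u)
  have hk : ∀ {C a}, HausdorffOp.IsDiagonalization A C a →
      Integrable (HausdorffOp.weightedKernel K a) μ := fun h => by
    refine hint.congr (.of_forall fun u => ?_)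
    simp only [HausdorffOp.abs_det_rpow h (hnega h), HausdorffOp.weightedKernel]
  -- A regular measure is finite on compact sets, so σ-compactness makes `μ` σ-finite, as Fubini
  -- requires.
  have hop : ∀ {C a} (h : HausdorffOp.IsDiagonalization A C a),
      HausdorffOp.IsHausdorffOperator μ K A
        (HausdorffOp.symbolOp h.1 (hk h) (HausdorffOp.aemeasurable_eigenvalue h hA)) :=
    fun h => HausdorffOp.isHausdorffOperator_symbolOp h hA (hk h) (hnega h)
  refine ⟨hdiag, ?_, ?_⟩
  · obtain ⟨C, a, h⟩ := hdiag
    exact ⟨_, hop h, fun T hT => hT.unique (hop h)⟩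
  · obtain ⟨U, hU⟩ := HausdorffOp.exists_hyperoctant_enumeration hn
    refine ⟨U, fun C a h => ⟨HausdorffOp.matrixSymbol_eq μ hn K a (hU a (hnega h)),
      fun T hT => ?_⟩⟩
    rw [hT.unique (hop h)]
    exact ⟨HausdorffOp.spectrum_symbolOp hn _ _ _, HausdorffOp.isLUB_norm_symbolOp hn _ _ _⟩
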